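/- **Setting.** Let $d\in\mathbb N$, let $\mathbb B^d$ be the open Euclidean unit ball of $\mathbb C^d$, and write $zw^*=\sum_i z_i\overline{w_i}$. For a Hilbert space $\mathcal H$ and $z\in\mathbb B^d$, write $z:\mathcal H\otimes\mathbb C^d\to\mathcal H$ for the row operator $(h_1,\dots,h_d)\mapsto\sum_i z_ih_i$ and $z^*$ for its adjoint. For a contraction $A$ put $D_A=\sqrt{I-A^*A}$. For Hilbert spaces $\mathcal J,\mathcal K$, the Schur class $\mathscr S_d(\mathcal J,\mathcal K)$ is the set of functions $b:\mathbb B^d\to\mathscr L(\mathcal J,\mathcal K)$ such that multiplication by $b$ is a contraction $H^2_d\otimes\mathcal J\to H^2_d\otimes\mathcal K$, where $H^2_d\otimes\mathcal J$ is the $\mathcal J$-valued reproducing kernel Hilbert space on $\mathbb B^d$ with kernel $(1-zw^*)^{-1}I_{\mathcal J}$. The support of $b$ is $\operatorname{supp}(b)=\bigvee_{z}\operatorname{ran} b(z)^*$ ($\bigvee$ denotes closed linear span). Functions $b_1,b_2$ *coincide* if there are constant unitaries $R,Q$ with $Rb_1(z)=b_2(z)Q$ for all $z\in\mathbb B^d$;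 they *coincide weakly* if $b_1|_{\operatorname{supp}(b_1)}$ and $b_2|_{\operatorname{supp}(b_2)}$ coincide. Let $T:\mathcal H\otimes\mathbb C^d\to\mathcal H$ be a row contraction ($\|T\|\le1$) that is CCNC, i.e. $\mathcal H=\bigvee_{z\in\mathbb B^d}(I-Tz^*)^{-1}\operatorname{ran}D_{T^*}$. Let $V=TP_{\ker D_T}$ be its partial isometric part. **The characteristic function $b_T$.** For a row partial isometry $V$ and $z\in\mathbb B^d$ let $\mathcal R(V-z)=\operatorname{ran}\big((V-z)V^*V\big)$. A model triple $(\gamma,\mathcal J_\infty,\mathcal J_0)$ for $V$ consists of Hilbert spaces $\mathcal J_\infty,\mathcal J_0$, a bounded invertible operator $\gamma(z):\mathcal J_0\to\mathcal R(V-z)^\perp$ for each $z\in\mathbb B^d$, with $\gamma(0)$ an onto isometry, and an onto isometry $\gamma(\infty):\mathcal J_\infty\to\ker V$. Put $$b_V^\gamma(z)=\big(\gamma(z)^*\gamma(0)\big)^{-1}\,z\,(\gamma(z)^*\otimes I_d)\gamma(\infty),\qquad \delta=-\gamma(0)^*T\gamma(\infty),$$ $$b_T^\gamma(z)=D_{\delta^*}^{-1}\big(b_V^\gamma(z)+\delta\big)\big(I+\delta^*b_V^\gamma(z)\big)^{-1}D_\delta\in\mathscr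 L(\mathcal J_\infty,\mathcal J_0),$$ where $D_{\delta^*}^{-1}$ is the (possibly unbounded) inverse of the injective operator $D_{\delta^*}$; that is, $b_T^\gamma(z)$ is the unique bounded operator $B$ with $D_{\delta^*}B=(b_V^\gamma(z)+\delta)(I+\delta^*b_V^\gamma(z))^{-1}D_\delta$. The (de Branges–Rovnyak) characteristic function $b_T$ of $T$ is any Schur class function, between arbitrary Hilbert spaces, that coincides weakly with $b_T^\gamma$ for a model triple of $V$. **The Sz.-Nagy–Foiaş characteristic function.** For $z\in\mathbb B^d$ let $$\Theta_T(z)=\big(-T+D_{T^*}(I-zT^*)^{-1}\,z\,D_T\big)\big|_{\overline{\operatorname{ran}}\,D_T}\in\mathscr L\big(\overline{\operatorname{ran}}\,D_T,\ \overline{\operatorname{ran}}\,D_{T^*}\big).$$ **Proposition.** Let $T$ be a CCNC row contraction. For every model triple $(\gamma,\mathcal J_\infty,\mathcal J_0)$ of its partial isometric part, $b_T^\gamma\in\mathscr S_d(\mathcal J_\infty,\mathcal J_0)$ and $\Theta_T\in\mathscr S_d(\overline{\operatorname{ran}}\,D_T,\overline{\operatorname{ran}}\,D_{T^*})$, and $b_T^\gamma$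 coincides weakly with $\Theta_T$. Consequently every Schur class function $b$ that coincides weakly with $b_T^\gamma$, i.e. every representative of the characteristic function $b_T$, coincides weakly with $\Theta_T$. -/

import Mathlib

open ContinuousLinearMap InnerProductSpace
open scoped InnerProduct

noncomputable section

namespace RowContraction

/-- The open unit ball `𝔹ᵈ` of `ℂᵈ` (Euclidean norm). -/
abbrev Ball (d : ℕ) : Type := Metric.ball (0 : EuclideanSpace ℂ (Fin d)) 1

/-- The origin of `𝔹ᵈ`. -/
def Ball.origin (d : ℕ) : Ball d := ⟨0, Metric.mem_ball_self one_pos⟩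

/-- The Hilbert space `H ⊗ ℂᵈ`, as the `ℓ²`-direct sum of `d` copies of `H`. -/
abbrev Copies (d : ℕ) (H : Type*) : Type _ := PiLp 2 (fun _ : Fin d => H)

/-! ### Defect operators -/

section Defect

variable {E F : Type*} [NormedAddCommGroup E] [InnerProductSpace ℂ E] [CompleteSpace E]
  [NormedAddCommGroup F] [InnerProductSpace ℂ F] [CompleteSpace F]

/-- The defect operator `D_A = √(I - A* A)` of a contraction `A`. -/
def defect (A : E →L[ℂ] F) : E →L[ℂ] E := CFC.sqrt (1 - A† ∘L A)

/-- The Hilbert space `(ran D_A)⁻`, the closure of the range of the defect operator. -/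
abbrev defectSpace (A : E →L[ℂ] F) : Submodule ℂ E :=
  (LinearMap.range (defect A).toLinearMap).topologicalClosure

/-- A pure contraction: `‖A x‖ < ‖x‖` for all nonzero `x`. -/
def IsPureContraction (A : E →L[ℂ] F) : Prop := ∀ x : E, x ≠ 0 → ‖A x‖ < ‖x‖

lemma one_sub_adjoint_comp_nonneg (A : E →L[ℂ] F) (hA : ‖A‖ ≤ 1) :
    0 ≤ (1 : E →L[ℂ] E) - A† ∘L A := by
  rw [ContinuousLinearMap.nonneg_iff_isPositive, ContinuousLinearMap.isPositive_def']
  refine ⟨?_, fun x => ?_⟩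
  · refine (IsSelfAdjoint.one _).sub ?_
    rw [isSelfAdjoint_iff, star_eq_adjoint, adjoint_comp, adjoint_adjoint]
  · have h1 : ‖A x‖ ≤ ‖x‖ := by simpa using A.le_of_opNorm_le hA x
    have h2 : ‖A x‖ ^ 2 ≤ ‖x‖ ^ 2 := by gcongr
    simp only [reApplyInnerSelf_apply, sub_apply, comp_apply, inner_sub_left,
      adjoint_inner_left, one_apply_eq_self, inner_self_eq_norm_sq_to_K, map_sub]
    norm_cast
    linarith

lemma defect_nonneg (A : E →L[ℂ] F) : 0 ≤ defect A := CFC.sqrt_nonneg _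

lemma defect_comp_defect (A : E →L[ℂ] F) (hA : ‖A‖ ≤ 1) :
    defect A ∘L defect A = 1 - A† ∘L A :=
  CFC.sqrt_mul_sqrt_self _ (one_sub_adjoint_comp_nonneg A hA)

lemma eq_zero_of_adjoint_comp_comp {G : Type*} [NormedAddCommGroup G] [InnerProductSpace ℂ G]
    [CompleteSpace G] (X : E →L[ℂ] F) (P : G →L[ℂ] E) (h : X† ∘L (X ∘L P) = 0) :
    X ∘L P = 0 := by
  ext x
  have h1 : (X†) (X (P x)) = 0 := by simpa using DFunLike.congr_fun h x
  have h2 : ⟪X (P x), X (P x)⟫_ℂ = 0 := by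
    rw [← adjoint_inner_left, h1, inner_zero_left]
  simpa using h2

/-- The intertwining relation `A D_A = D_{A*} A`. -/
lemma comp_defect (A : E →L[ℂ] F) (hA : ‖A‖ ≤ 1) :
    A ∘L defect A = defect (A†) ∘L A := by
  have hP : defect A ∘L defect A = 1 - A† ∘L A := defect_comp_defect A hA
  have hQ : defect (A†) ∘L defect (A†) = 1 - A ∘L A† := by
    simpa using defect_comp_defect (A†) (by simpa using hA)
  have hP0 := defect_nonneg A
  have hQ0 := defect_nonneg (A†)
  have hPs : (defect A)† = defect A := (IsSelfAdjoint.of_nonneg hP0).star_eq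
  have hQs : (defect (A†))† = defect (A†) := (IsSelfAdjoint.of_nonneg hQ0).star_eq
  generalize defect A = P at *
  generalize defect (A†) = Q at *
  set X : E →L[ℂ] F := Q ∘L A - A ∘L P with hX
  have hPx : ∀ x, P (P x) = x - (A†) (A x) := fun x => by simpa using DFunLike.congr_fun hP x
  have hQx : ∀ x, Q (Q x) = x - A ((A†) x) := fun x => by simpa using DFunLike.congr_fun hQ x
  have hQX : Q ∘L X = -(X ∘L P) := by
    ext x; simp [hX, hPx, hQx]
  have hW0 : 0 ≤ (X† ∘L X : E →L[ℂ] E) := by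
    rw [nonneg_iff_isPositive]; exact isPositive_adjoint_comp_self X
  have hM0 : 0 ≤ (X† ∘L Q ∘L X : E →L[ℂ] E) := by
    rw [nonneg_iff_isPositive] at hQ0 ⊢
    simpa using hQ0.adjoint_conj X
  have hWP : (X† ∘L X) * P = -(X† ∘L Q ∘L X) := by
    rw [hQX]; ext x; simp
  have hMs : star (X† ∘L Q ∘L X) = X† ∘L Q ∘L X := (IsSelfAdjoint.of_nonneg hM0).star_eq
  have hPW : P * (X† ∘L X) = -(X† ∘L Q ∘L X) := by
    have := congrArg star hWP
    rw [star_mul, star_neg, hMs, (IsSelfAdjoint.of_nonneg hW0).star_eq,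
      (IsSelfAdjoint.of_nonneg hP0).star_eq] at this
    exact this
  have hc : Commute (X† ∘L X) P := hWP.trans hPW.symm
  have hM : X† ∘L Q ∘L X = 0 := by
    have := Commute.mul_nonneg hW0 hP0 hc
    rw [hWP] at this
    exact le_antisymm (by simpa using this) hM0
  have hXP : X ∘L P = 0 := by
    apply eq_zero_of_adjoint_comp_comp
    have h := hWP
    rw [hM, neg_zero] at h
    exact h
  have hPX : P ∘L X† = 0 := by
    have := congrArg adjoint hXP
    simpa [adjoint_comp, hPs] using this
  have hXQ : X† ∘L Q = 0 := by
    have := congrArg adjoint hQX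
    simpa [adjoint_comp, hQs, hXP] using this
  have hW1 : X† ∘L X = -(X† ∘L A ∘L P) := by
    ext x
    have h1 : (X†) (Q (A x)) = 0 := by simpa using DFunLike.congr_fun hXQ (A x)
    have h2 : X x = Q (A x) - A (P x) := by simp [hX]
    simp only [comp_apply, neg_apply]
    rw [h2, map_sub, h1, zero_sub]
  have hXX : X ∘L (X† ∘L X) = 0 := by
    apply eq_zero_of_adjoint_comp_comp
    have h : (X† ∘L X) ∘L (X† ∘L X) = 0 := by
      nth_rewrite 1 [hW1]
      ext x
      have h1 : P ((X†) (X x)) = 0 := by simpa using DFunLike.congr_fun hPX (X x)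
      simp [h1]
    exact h
  have hWW : X† ∘L X = 0 := by
    have := eq_zero_of_adjoint_comp_comp (X†) X (by simpa using hXX)
    exact this
  have hX0 : X ∘L (1 : E →L[ℂ] E) = 0 := eq_zero_of_adjoint_comp_comp X 1 hWW
  have hX1 : X = 0 := hX0
  rw [hX, sub_eq_zero] at hX1
  exact hX1.symm

/-- A contraction maps its defect space into the defect space of its adjoint. -/
lemma map_mem_defectSpace (A : E →L[ℂ] F) (hA : ‖A‖ ≤ 1) {x : E} (hx : x ∈ defectSpace A) :
    A x ∈ defectSpace (A†) := by
  have hle : defectSpace A ≤ (defectSpace (A†)).comap A.toLinearMap := by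
    refine Submodule.topologicalClosure_minimal _ ?_ ?_
    · rintro _ ⟨y, rfl⟩
      refine Submodule.le_topologicalClosure _ ⟨A y, ?_⟩
      exact (DFunLike.congr_fun (comp_defect A hA) y).symm
    · exact (Submodule.isClosed_topologicalClosure _).preimage A.continuous
  exact hle hx

lemma defect_injective (A : E →L[ℂ] F) (hA : ‖A‖ ≤ 1) (hp : IsPureContraction A) :
    Function.Injective (defect A) := by
  refine (injective_iff_map_eq_zero _).2 fun x hx => ?_
  by_contra h0
  have h1 : defect A (defect A x) = x - (A†) (A x) := by
    simpa using DFunLike.congr_fun (defect_comp_defect A hA) x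
  rw [hx, map_zero, eq_comm, sub_eq_zero] at h1
  have h2 : ⟪A x, A x⟫_ℂ = ⟪x, x⟫_ℂ := by
    rw [← adjoint_inner_left, ← h1]
  have h3 : ‖A x‖ ^ 2 = ‖x‖ ^ 2 := by
    rw [inner_self_eq_norm_sq_to_K, inner_self_eq_norm_sq_to_K] at h2
    exact_mod_cast h2
  have h4 := hp x h0
  have h5 := norm_nonneg (A x)
  nlinarith

lemma IsPureContraction.adjoint {A : E →L[ℂ] F} (hA : ‖A‖ ≤ 1) (hp : IsPureContraction A) :
    IsPureContraction (A†) := by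
  intro y hy
  have hle : ‖(A†) y‖ ≤ ‖y‖ := by
    have hA' : ‖A†‖ ≤ 1 := by simpa using hA
    simpa using (A†).le_of_opNorm_le hA' y
  by_contra hlt
  have heq : ‖(A†) y‖ = ‖y‖ := le_antisymm hle (not_lt.1 hlt)
  have hne : (A†) y ≠ 0 := fun h => hy (by simpa [h, eq_comm] using heq)
  have h1 : ‖A ((A†) y)‖ < ‖(A†) y‖ := hp _ hne
  have h2 : ‖(A†) y‖ ^ 2 ≤ ‖y‖ * ‖A ((A†) y)‖ := by
    have h3 : ⟪(A†) y, (A†) y⟫_ℂ = ⟪y, A ((A†) y)⟫_ℂ := adjoint_inner_left A _ y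
    have h4 : ‖⟪(A†) y, (A†) y⟫_ℂ‖ = ‖(A†) y‖ ^ 2 := by
      rw [inner_self_eq_norm_sq_to_K]; simp
    rw [← h4, h3]; exact norm_inner_le_norm _ _
  have h5 : 0 < ‖y‖ := norm_pos_iff.2 hy
  rw [heq] at h1 h2
  nlinarith

/-! ### The inverse Frostman transformation -/

/-- The inverse Frostman transformation
`Φ_α⁻¹(β) = D_{α*}⁻¹ (β + α) (I + α* β)⁻¹ D_α`, for `α` a pure contraction and `‖β‖ < 1`.
Here `D_{α*}` is injective and `D_{α*}⁻¹` is its (possibly unbounded) inverse, defined on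
`ran D_{α*}`; so `Φ_α⁻¹(β)` is the bounded operator `B` with
`D_{α*} B = (β + α) (I + α* β)⁻¹ D_α`. Existence and uniqueness of `B` are
`defect_comp_inverseFrostman` and `eq_inverseFrostman` below. -/
def inverseFrostman (α β : E →L[ℂ] F) : E →L[ℂ] F :=
  open Classical in
  if h : ∃ B : E →L[ℂ] F,
      defect (α†) ∘L B = (β + α) ∘L Ring.inverse (1 + α† ∘L β) ∘L defect α
    then h.choose else 0

lemma defect_comp_inverseFrostman (α β : E →L[ℂ] F) (hα : ‖α‖ ≤ 1) (hβ : ‖β‖ < 1) :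
    defect (α†) ∘L inverseFrostman α β =
      (β + α) ∘L Ring.inverse (1 + α† ∘L β) ∘L defect α := by
  have h : ∃ B : E →L[ℂ] F,
      defect (α†) ∘L B = (β + α) ∘L Ring.inverse (1 + α† ∘L β) ∘L defect α := by
    have hu : IsUnit (1 + α† ∘L β : E →L[ℂ] E) := by
      have hn : ‖-(α† ∘L β)‖ < 1 := by
        rw [norm_neg]
        calc ‖α† ∘L β‖ ≤ ‖α†‖ * ‖β‖ := opNorm_comp_le _ _
          _ ≤ 1 * ‖β‖ := by gcongr; simpa using hα
          _ < 1 := by simpa using hβ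
      simpa using isUnit_one_sub_of_norm_lt_one hn
    have hinv := Ring.mul_inverse_cancel _ hu
    set R := Ring.inverse (1 + α† ∘L β : E →L[ℂ] E) with hR
    refine ⟨α + defect (α†) ∘L β ∘L R ∘L defect α, ?_⟩
    have hQ : defect (α†) ∘L defect (α†) = 1 - α ∘L α† := by
      simpa using defect_comp_defect (α†) (by simpa using hα)
    have hI := comp_defect α hα
    ext x
    have h1 : ∀ y, R y + (α†) (β (R y)) = y := fun y => by
      simpa using DFunLike.congr_fun hinv y
    have h2 : ∀ y, defect (α†) (defect (α†) y) = y - α ((α†) y) := fun y => by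
      simpa using DFunLike.congr_fun hQ y
    have h3 : defect (α†) (α x) = α (defect α x) := (DFunLike.congr_fun hI x).symm
    have h4 : α (defect α x) = α (R (defect α x)) + α ((α†) (β (R (defect α x)))) := by
      rw [← map_add, h1]
    simp only [comp_apply, add_apply, map_add, h2, h3]
    rw [h4]; abel
  unfold inverseFrostman
  rw [dif_pos h]
  exact h.choose_spec

lemma eq_inverseFrostman (α β B : E →L[ℂ] F) (hα : ‖α‖ ≤ 1) (hp : IsPureContraction α)
    (hβ : ‖β‖ < 1)
    (hB : defect (α†) ∘L B = (β + α) ∘L Ring.inverse (1 + α† ∘L β) ∘L defect α) :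
    B = inverseFrostman α β := by
  ext x
  apply defect_injective (α†) (by simpa using hα) (hp.adjoint hα)
  exact DFunLike.congr_fun (hB.trans (defect_comp_inverseFrostman α β hα hβ).symm) x

end Defect

/-! ### Vector-valued Drury–Arveson spaces and the Schur class -/

section Schur

open RKHS

/-- The operator-valued Szegő kernel `k(z, w) = (1 - z w*)⁻¹ I` on the ball,
where `z w* = ∑ᵢ zᵢ conj wᵢ`. -/
def szegoKernel (d : ℕ) (J : Type*) [NormedAddCommGroup J] [InnerProductSpace ℂ J] :
    Matrix (Ball d) (Ball d) (J →L[ℂ] J) :=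
  .of fun z w => (1 - ⟪(w : EuclideanSpace ℂ (Fin d)), z⟫_ℂ)⁻¹ • ContinuousLinearMap.id ℂ J

lemma re_sum_inner_pow_mul_inner_nonneg {ι : Type*} (d n : ℕ) (s : Finset ι)
    (x : ι → EuclideanSpace ℂ (Fin d)) : ∀ {V : Type*} [NormedAddCommGroup V]
    [InnerProductSpace ℂ V] (v : ι → V),
    0 ≤ (∑ i ∈ s, ∑ j ∈ s, ⟪x j, x i⟫_ℂ ^ n * ⟪v i, v j⟫_ℂ).re := by
  induction n with
  | zero =>
    intro V _ _ v
    have : (∑ i ∈ s, ∑ j ∈ s, ⟪x j, x i⟫_ℂ ^ 0 * ⟪v i, v j⟫_ℂ) =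
        ⟪∑ i ∈ s, v i, ∑ i ∈ s, v i⟫_ℂ := by
      rw [sum_inner]
      simp_rw [inner_sum, pow_zero, one_mul]
    rw [this]
    exact inner_self_nonneg (𝕜 := ℂ)
  | succ n ih =>
    intro V _ _ v
    have := ih (V := Copies d V)
      (fun i => WithLp.toLp 2 fun k => (starRingEnd ℂ) (x i k) • v i)
    convert this using 2
    refine Finset.sum_congr rfl fun i _ => Finset.sum_congr rfl fun j _ => ?_
    rw [pow_succ, mul_assoc]
    congr 1
    rw [PiLp.inner_apply, PiLp.inner_apply, Finset.sum_mul]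
    refine Finset.sum_congr rfl fun k _ => ?_
    simp [inner_smul_left, inner_smul_right]
    ring

lemma norm_inner_lt_one {d : ℕ} (z w : Ball d) :
    ‖⟪(w : EuclideanSpace ℂ (Fin d)), z⟫_ℂ‖ < 1 := by
  have hz : ‖(z : EuclideanSpace ℂ (Fin d))‖ < 1 := by exact mem_ball_zero_iff.1 z.2
  have hw : ‖(w : EuclideanSpace ℂ (Fin d))‖ < 1 := by exact mem_ball_zero_iff.1 w.2
  have := norm_inner_le_norm (𝕜 := ℂ) (w : EuclideanSpace ℂ (Fin d)) z
  nlinarith [norm_nonneg (z : EuclideanSpace ℂ (Fin d)),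
    norm_nonneg (w : EuclideanSpace ℂ (Fin d))]

lemma szegoKernel_posSemidef (d : ℕ) (J : Type*) [NormedAddCommGroup J]
    [InnerProductSpace ℂ J] [CompleteSpace J] : (szegoKernel d J).PosSemidef := by
  have htfae := posSemidef_tfae (K := szegoKernel d J)
  have hiff := htfae.out 0 2 rfl rfl
  refine hiff.2 ⟨?_, fun vv => ?_⟩
  · ext z w : 1
    simp only [szegoKernel, Matrix.conjTranspose_apply, Matrix.of_apply]
    rw [star_smul, ← ContinuousLinearMap.one_def, star_one]
    simp
  · have hs : ∀ z w : Ball d, HasSum (fun n : ℕ => ⟪(w : EuclideanSpace ℂ (Fin d)), z⟫_ℂ ^ n)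
        (1 - ⟪(w : EuclideanSpace ℂ (Fin d)), z⟫_ℂ)⁻¹ := fun z w =>
      hasSum_geometric_of_norm_lt_one (norm_inner_lt_one z w)
    have hS : HasSum (fun n : ℕ => (∑ i ∈ vv.support, ∑ j ∈ vv.support,
        ⟪(j : EuclideanSpace ℂ (Fin d)), i⟫_ℂ ^ n * ⟪vv i, vv j⟫_ℂ))
        (∑ i ∈ vv.support, ∑ j ∈ vv.support,
          (1 - ⟪(j : EuclideanSpace ℂ (Fin d)), i⟫_ℂ)⁻¹ * ⟪vv i, vv j⟫_ℂ) :=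
      hasSum_sum fun i _ => hasSum_sum fun j _ => (hs i j).mul_right _
    have hR := Complex.hasSum_re hS
    have h0 := hR.nonneg fun n =>
      re_sum_inner_pow_mul_inner_nonneg d n vv.support (fun z : Ball d => (z : _)) vv
    refine h0.trans_eq ?_
    rw [RCLike.re_eq_complex_re]
    congr 1
    simp [Finsupp.sum, szegoKernel, inner_smul_left]

instance fact_szegoKernel_posSemidef (d : ℕ) (J : Type*) [NormedAddCommGroup J]
    [InnerProductSpace ℂ J] [CompleteSpace J] : Fact (szegoKernel d J).PosSemidef :=
  ⟨szegoKernel_posSemidef d J⟩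

/-- The `J`-valued Drury–Arveson space `H²_d ⊗ J`: the reproducing kernel Hilbert space of
`J`-valued functions on the ball with the operator-valued Szegő kernel. -/
abbrev DruryArveson (d : ℕ) (J : Type*) [NormedAddCommGroup J] [InnerProductSpace ℂ J]
    [CompleteSpace J] : Type _ := OfKernel (szegoKernel d J)

variable {J K : Type*} [NormedAddCommGroup J] [InnerProductSpace ℂ J] [CompleteSpace J]
  [NormedAddCommGroup K] [InnerProductSpace ℂ K] [CompleteSpace K]

/-- `b` belongs to the Schur class `S_d(J, K)`: multiplication by `b` is a contraction from
`H²_d ⊗ J` to `H²_d ⊗ K`. -/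
def IsSchur {d : ℕ} (b : Ball d → J →L[ℂ] K) : Prop :=
  ∃ M : DruryArveson d J →L[ℂ] DruryArveson d K,
    ‖M‖ ≤ 1 ∧ ∀ (f : DruryArveson d J) (z : Ball d), M f z = b z (f z)

/-- The support `⋁_z ran b(z)*` of an operator-valued function on the ball. -/
def support {d : ℕ} (b : Ball d → J →L[ℂ] K) : Submodule ℂ J :=
  (⨆ z : Ball d, LinearMap.range ((b z)†).toLinearMap).topologicalClosure

/-- The restriction of an operator-valued function on the ball to its support. -/
def restrictSupport {d : ℕ} (b : Ball d → J →L[ℂ] K) (z : Ball d) : support b →L[ℂ] K :=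
  b z ∘L (support b).subtypeL

end Schur

section Coincide

/-- Operator-valued functions `b₁, b₂` on the ball coincide if there are constant unitaries `R`,
`Q` with `R b₁(z) = b₂(z) Q` for all `z`. -/
def Coincide {d : ℕ} {E₁ F₁ E₂ F₂ : Type*}
    [NormedAddCommGroup E₁] [InnerProductSpace ℂ E₁]
    [NormedAddCommGroup F₁] [InnerProductSpace ℂ F₁]
    [NormedAddCommGroup E₂] [InnerProductSpace ℂ E₂]
    [NormedAddCommGroup F₂] [InnerProductSpace ℂ F₂]
    (b₁ : Ball d → E₁ →L[ℂ] F₁) (b₂ : Ball d → E₂ →L[ℂ] F₂) : Prop :=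
  ∃ (R : F₁ ≃ₗᵢ[ℂ] F₂) (Q : E₁ ≃ₗᵢ[ℂ] E₂), ∀ (z : Ball d) (x : E₁), R (b₁ z x) = b₂ z (Q x)

/-- `b₁` and `b₂` coincide weakly: their restrictions to their supports coincide. -/
def CoincideWeakly {d : ℕ} {E₁ F₁ E₂ F₂ : Type*}
    [NormedAddCommGroup E₁] [InnerProductSpace ℂ E₁] [CompleteSpace E₁]
    [NormedAddCommGroup F₁] [InnerProductSpace ℂ F₁] [CompleteSpace F₁]
    [NormedAddCommGroup E₂] [InnerProductSpace ℂ E₂] [CompleteSpace E₂]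
    [NormedAddCommGroup F₂] [InnerProductSpace ℂ F₂] [CompleteSpace F₂]
    (b₁ : Ball d → E₁ →L[ℂ] F₁) (b₂ : Ball d → E₂ →L[ℂ] F₂) : Prop :=
  Coincide (restrictSupport b₁) (restrictSupport b₂)

end Coincide

/-! ### Row contractions and their characteristic functions -/

section Row

variable {d : ℕ} {H : Type*} [NormedAddCommGroup H] [InnerProductSpace ℂ H] [CompleteSpace H]

variable (H) in
/-- The row operator `z : H ⊗ ℂᵈ → H`, `(h₁, …, h_d) ↦ z₁ h₁ + ⋯ + z_d h_d`. Its adjoint is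
`z* : h ↦ (conj z₁ h, …, conj z_d h)`. -/
def rowOp (z : Ball d) : Copies d H →L[ℂ] H :=
  ∑ i, (z : EuclideanSpace ℂ (Fin d)) i • PiLp.proj (𝕜 := ℂ) 2 (fun _ : Fin d => H) i

/-- The commutative CNC condition `H = ⋁_z (I - T z*)⁻¹ ran D_{T*}`. For a row contraction `T`
and `z` in the ball, `‖T z*‖ < 1`, so `I - T z*` is invertible. -/
def IsCCNC (T : Copies d H →L[ℂ] H) : Prop :=
  (⨆ z : Ball d, (LinearMap.range (defect (T†)).toLinearMap).map
    (Ring.inverse (1 - T ∘L (rowOp H z)†)).toLinearMap).topologicalClosure = ⊤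

/-- The partial isometric part `V = T P_{ker D_T}` of a row contraction `T`, from the
isometric-pure decomposition `T = V - C`, `C = -T P_{(ker D_T)ᗮ}`. -/
def isometricPart (T : Copies d H →L[ℂ] H) : Copies d H →L[ℂ] H :=
  T ∘L (LinearMap.ker (defect T).toLinearMap).starProjection

/-- The restricted range space `ran ((V - z) V* V)`. -/
def restrictedRange (V : Copies d H →L[ℂ] H) (z : Ball d) : Submodule ℂ H :=
  LinearMap.range ((V - rowOp H z) ∘L V† ∘L V).toLinearMap

/-- A model triple `(γ, J∞, J₀)` of a row partial isometry `V`: for every `z` in the ball a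
bounded linear isomorphism `γ(z)` of `J₀` onto `ran ((V - z) V* V)ᗮ`, isometric for `z = 0`, and
an onto isometry `γ(∞) : J∞ → ker V`. The map `z ↦ γ(z)` is arbitrary otherwise. -/
structure ModelTriple (V : Copies d H →L[ℂ] H) (Jinf J₀ : Type*)
    [NormedAddCommGroup Jinf] [InnerProductSpace ℂ Jinf]
    [NormedAddCommGroup J₀] [InnerProductSpace ℂ J₀] where
  /-- `γ(z)` for `z` in the ball -/
  equiv (z : Ball d) : J₀ ≃L[ℂ] (restrictedRange V z)ᗮ
  /-- `γ(0)` is isometric -/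
  norm_equiv_origin (x : J₀) : ‖equiv (Ball.origin d) x‖ = ‖x‖
  /-- `γ(∞)` -/
  equivInf : Jinf ≃ₗᵢ[ℂ] LinearMap.ker V.toLinearMap

namespace ModelTriple

variable {Jinf J₀ : Type*}
  [NormedAddCommGroup Jinf] [InnerProductSpace ℂ Jinf] [CompleteSpace Jinf]
  [NormedAddCommGroup J₀] [InnerProductSpace ℂ J₀] [CompleteSpace J₀]
  {V : Copies d H →L[ℂ] H}

/-- `γ(z)` as an operator from `J₀` to `H`. -/
def toH (γ : ModelTriple V Jinf J₀) (z : Ball d) : J₀ →L[ℂ] H :=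
  (restrictedRange V z)ᗮ.subtypeL ∘L (γ.equiv z).toContinuousLinearMap

/-- `γ(∞)` as an operator from `J∞` to `H ⊗ ℂᵈ`. -/
def inf (γ : ModelTriple V Jinf J₀) : Jinf →L[ℂ] Copies d H :=
  (LinearMap.ker V.toLinearMap).subtypeL ∘L
    γ.equivInf.toContinuousLinearEquiv.toContinuousLinearMap

/-- The coordinatewise action `A ⊗ I_d : E ⊗ ℂᵈ → F ⊗ ℂᵈ` of an operator `A : E → F`. -/
def ampliate {E F : Type*} [NormedAddCommGroup E] [InnerProductSpace ℂ E]
    [NormedAddCommGroup F] [InnerProductSpace ℂ F] (d : ℕ) (A : E →L[ℂ] F) :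
    Copies d E →L[ℂ] Copies d F :=
  (PiLp.continuousLinearEquiv 2 ℂ (fun _ : Fin d => F)).symm.toContinuousLinearMap ∘L
    ContinuousLinearMap.pi fun i => A ∘L PiLp.proj (𝕜 := ℂ) 2 (fun _ : Fin d => E) i

/-- `D(z) = γ(z)* γ(0)`. -/
def denominator (γ : ModelTriple V Jinf J₀) (z : Ball d) : J₀ →L[ℂ] J₀ :=
  (γ.toH z)† ∘L γ.toH (Ball.origin d)

/-- `N(z) = (γ(z)* ⊗ I_d) γ(∞)`. -/
def numerator (γ : ModelTriple V Jinf J₀) (z : Ball d) : Jinf →L[ℂ] Copies d J₀ :=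
  ampliate d ((γ.toH z)†) ∘L γ.inf

/-- The representative `b_V(z) = D(z)⁻¹ z N(z)` of the characteristic function of the row partial
isometry `V` given by a model triple. -/
def charFunIsometric (γ : ModelTriple V Jinf J₀) (z : Ball d) : Jinf →L[ℂ] J₀ :=
  Ring.inverse (γ.denominator z) ∘L rowOp J₀ z ∘L γ.numerator z

/-- The zero-point contraction `δ = -γ(0)* T γ(∞)` of a row contraction `T`. -/
def zeroPoint (γ : ModelTriple V Jinf J₀) (T : Copies d H →L[ℂ] H) : Jinf →L[ℂ] J₀ :=
  -((γ.toH (Ball.origin d))† ∘L T ∘L γ.inf)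

end ModelTriple

/-- The representative `b_T` of the (de Branges–Rovnyak) characteristic function of the row
contraction `T` given by a model triple of its partial isometric part `V`: the inverse Frostman
transform `D_{δ*}⁻¹ (b_V(z) + δ) (I + δ* b_V(z))⁻¹ D_δ` of `b_V`, with `δ` the zero-point
contraction of `T`. -/
def charFun {Jinf J₀ : Type*}
    [NormedAddCommGroup Jinf] [InnerProductSpace ℂ Jinf] [CompleteSpace Jinf]
    [NormedAddCommGroup J₀] [InnerProductSpace ℂ J₀] [CompleteSpace J₀]
    (T : Copies d H →L[ℂ] H) (γ : ModelTriple (isometricPart T) Jinf J₀) (z : Ball d) :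
    Jinf →L[ℂ] J₀ :=
  inverseFrostman (γ.zeroPoint T) (γ.charFunIsometric z)

/-- The operator `-T + D_{T*} (I - z T*)⁻¹ z D_T` from `H ⊗ ℂᵈ` to `H`. -/
def nagyFoiasAux (T : Copies d H →L[ℂ] H) (z : Ball d) : Copies d H →L[ℂ] H :=
  -T + defect (T†) ∘L Ring.inverse (1 - rowOp H z ∘L T†) ∘L rowOp H z ∘L defect T

lemma nagyFoiasAux_mem (T : Copies d H →L[ℂ] H) (hT : ‖T‖ ≤ 1) (z : Ball d)
    (x : defectSpace T) : nagyFoiasAux T z x ∈ defectSpace (T†) := by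
  refine Submodule.add_mem _ ?_ ?_
  · exact Submodule.neg_mem _ (map_mem_defectSpace T hT x.2)
  · exact Submodule.le_topologicalClosure _ ⟨_, rfl⟩

/-- The Sz.-Nagy–Foiaş characteristic function
`Θ_T(z) = (-T + D_{T*} (I - z T*)⁻¹ z D_T) |_{(ran D_T)⁻}`, with values in the bounded operators
from `(ran D_T)⁻` to `(ran D_{T*})⁻`. -/
def nagyFoias (T : Copies d H →L[ℂ] H) (hT : ‖T‖ ≤ 1) (z : Ball d) :
    defectSpace T →L[ℂ] defectSpace (T†) :=
  (nagyFoiasAux T z ∘L (defectSpace T).subtypeL).codRestrict (defectSpace (T†))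
    (nagyFoiasAux_mem T hT z)

end Row

end RowContraction

end

open RowContraction

/-! Up to unitaries the two characteristic functions are the same function: `γ(0) b_T(z) = Θ_T(z)
γ(∞)` (`toH_charFun`). Let `V` be the partial isometric part of `T`. Since `ker V` is the defect
space of `T` and `(ran V)ᗮ = ker V*` is that of `T*`, `γ(∞)` and `γ(0)` are unitaries onto these
defect spaces. This gives coincidence, hence weak coincidence, and weak coincidence is transitive.

For the identity, the model formula first reduces to `γ(0) b_V(z) = (I - V V*)(I - z V*)⁻¹ z γ(∞)`
(`toH_charFunIsometric`), so that the choice of `γ(z)` for `z ≠ 0` drops out, and `‖b_V(z)‖ ≤ ‖z‖`.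
The same unitaries carry `δ`, `D_δ`, `D_{δ*}` to the restrictions of `-T`, `D_T`, `D_{T*}`. Hence
`γ(0)* Θ_T(z) γ(∞)` can be checked directly against the equation defining the inverse Frostman
transform, whose solution is unique because `δ` is pure.

Schur membership comes from `I - Θ(z) Θ(w)* = (1 - z w*) G(z) G(w)*` with `G(z) = D_{T*}(I - z
T*)⁻¹`: a factorization of this kind makes the adjoint of multiplication contractive on kernel
functions. It passes to `b_T` through the unitaries. -/

namespace RowContraction

/-! ### Kernel factorizations and the Schur class. -/

section SchurCriterion

open RKHS

variable {d : ℕ} {J K X : Type*} [NormedAddCommGroup J] [InnerProductSpace ℂ J] [CompleteSpace J]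
  [NormedAddCommGroup K] [InnerProductSpace ℂ K] [CompleteSpace K]
  [NormedAddCommGroup X] [InnerProductSpace ℂ X] [CompleteSpace X]

lemma one_sub_inner_ne_zero (z w : Ball d) :
    (1 : ℂ) - ⟪(w : EuclideanSpace ℂ (Fin d)), z⟫_ℂ ≠ 0 := by
  intro h
  have h1 := norm_inner_lt_one z w
  rw [← sub_eq_zero.1 h, norm_one] at h1
  exact lt_irrefl _ h1

lemma DruryArveson.kerFun_apply (w z : Ball d) (v : J) :
    kerFun (DruryArveson d J) w v z =
      (1 - ⟪(w : EuclideanSpace ℂ (Fin d)), z⟫_ℂ)⁻¹ • v := by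
  rw [RKHS.kerFun_apply, OfKernel.kernel_ofKernel]
  simp [szegoKernel]

lemma DruryArveson.inner_kerFun_kerFun (w z : Ball d) (u v : J) :
    ⟪kerFun (DruryArveson d J) w u, kerFun (DruryArveson d J) z v⟫_ℂ =
      (1 - ⟪(z : EuclideanSpace ℂ (Fin d)), w⟫_ℂ)⁻¹ * ⟪u, v⟫_ℂ := by
  rw [kerFun_inner, DruryArveson.kerFun_apply, inner_smul_right]

/-- A function with `I - b(z) b(w)* = (1 - z w*) G(z) G(w)*` belongs to the Schur class. -/
theorem isSchur_of_factorization (b : Ball d → J →L[ℂ] K) (G : Ball d → X →L[ℂ] K)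
    (h : ∀ (z w : Ball d) (y : K), y - b z (((b w)†) y) =
      (1 - ⟪(w : EuclideanSpace ℂ (Fin d)), z⟫_ℂ) • G z (((G w)†) y)) : IsSchur b := by
  -- For formal combinations of pairs `(w, y)`: `e` gives the kernel functions `k_w y`, `f` their
  -- prospective images `k_w b(w)* y` under the adjoint of multiplication, and `g` the vectors
  -- `G(w)* y`, which account for the loss of norm.
  set e : (Ball d × K →₀ ℂ) →ₗ[ℂ] DruryArveson d K :=
    Finsupp.linearCombination ℂ fun p => kerFun (DruryArveson d K) p.1 p.2 with he
  set f : (Ball d × K →₀ ℂ) →ₗ[ℂ] DruryArveson d J :=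
    Finsupp.linearCombination ℂ fun p => kerFun (DruryArveson d J) p.1 (((b p.1)†) p.2) with hf
  set g : (Ball d × K →₀ ℂ) →ₗ[ℂ] X :=
    Finsupp.linearCombination ℂ fun p => ((G p.1)†) p.2 with hg
  -- By sesquilinearity it suffices to take generators, where this is the factorization divided by
  -- `1 - z w*`.
  have hgram : ∀ x y, ⟪e x, e y⟫_ℂ = ⟪f x, f y⟫_ℂ + ⟪g x, g y⟫_ℂ := by
    intro x y
    induction x using Finsupp.induction_linear with
    | zero => simp
    | add x₁ x₂ h₁ h₂ => simp only [map_add, inner_add_left, h₁, h₂]; ring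
    | single p a =>
      induction y using Finsupp.induction_linear with
      | zero => simp
      | add x₁ x₂ h₁ h₂ => simp only [map_add, inner_add_right, h₁, h₂]; ring
      | single q c =>
        have hpq := congrArg (fun t => ⟪p.2, t⟫_ℂ) (h p.1 q.1 q.2)
        simp only [inner_sub_right, inner_smul_right] at hpq
        have h0 := one_sub_inner_ne_zero p.1 q.1
        simp only [he, hf, hg, Finsupp.linearCombination_single, inner_smul_left,
          inner_smul_right, DruryArveson.inner_kerFun_kerFun, adjoint_inner_left]
        field_simp
        linear_combination ((starRingEnd ℂ) a * c) * hpq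
  have hle : ∀ x, ‖f x‖ ≤ 1 * ‖e x‖ := by
    intro x
    have h1 := hgram x x
    simp only [inner_self_eq_norm_sq_to_K] at h1
    have h2 : ‖e x‖ ^ 2 = ‖f x‖ ^ 2 + ‖g x‖ ^ 2 := by exact_mod_cast h1
    rw [one_mul]
    exact abs_le_of_sq_le_sq' (by nlinarith [sq_nonneg ‖g x‖]) (norm_nonneg _) |>.2
  have hdense : DenseRange e := by
    have h1 := kerFun_dense (𝕜 := ℂ) (DruryArveson d K)
    have h2 : LinearMap.range e =
        Submodule.span ℂ {kerFun (DruryArveson d K) x v | (x) (v)} := by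
      rw [he, Finsupp.range_linearCombination]
      congr 1
      ext t
      simp
    rw [← h2] at h1
    have h3 := (Submodule.dense_iff_topologicalClosure_eq_top).2 h1
    exact h3
  -- The assignment `e x ↦ f x` is well defined and contractive by `hle`, and extends from a dense
  -- range.
  set N : DruryArveson d K →L[ℂ] DruryArveson d J := f.extendOfNorm e with hN
  have hNker : ∀ (z : Ball d) (y : K), N (kerFun (DruryArveson d K) z y) =
      kerFun (DruryArveson d J) z (((b z)†) y) := by
    intro z y
    have := LinearMap.extendOfNorm_eq hdense ⟨1, hle⟩ (Finsupp.single (z, y) 1)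
    simpa [he, hf] using this
  refine ⟨N†, ?_, fun φ z => ?_⟩
  · rw [LinearIsometryEquiv.norm_map]
    exact opNorm_le_bound _ zero_le_one
      (LinearMap.norm_extendOfNorm_apply_le hdense 1 hle)
  · refine ext_inner_left ℂ fun v => ?_
    rw [← kerFun_inner, adjoint_inner_right, hNker, kerFun_inner, adjoint_inner_left]

/-- Functions that coincide have the same factorizations, so that the Schur class criterion
transfers along constant unitaries. -/
theorem isSchur_of_coincide_of_factorization {E F : Type*}
    [NormedAddCommGroup E] [InnerProductSpace ℂ E] [CompleteSpace E]
    [NormedAddCommGroup F] [InnerProductSpace ℂ F] [CompleteSpace F]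
    (a : Ball d → E →L[ℂ] F) (b : Ball d → J →L[ℂ] K) (hab : Coincide a b)
    (G : Ball d → X →L[ℂ] K)
    (h : ∀ (z w : Ball d) (y : K), y - b z (((b w)†) y) =
      (1 - ⟪(w : EuclideanSpace ℂ (Fin d)), z⟫_ℂ) • G z (((G w)†) y)) : IsSchur a := by
  obtain ⟨R, Q, hRQ⟩ := hab
  refine isSchur_of_factorization a
    (fun z => R.symm.toContinuousLinearEquiv.toContinuousLinearMap ∘L G z) fun z w y => ?_
  have hadj : ∀ y, Q (((a w)†) y) = ((b w)†) (R y) := fun y => by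
    refine ext_inner_right ℂ fun v => ?_
    obtain ⟨x, rfl⟩ := Q.surjective v
    rw [LinearIsometryEquiv.inner_map_map, adjoint_inner_left, adjoint_inner_left, ← hRQ,
      LinearIsometryEquiv.inner_map_map]
  have hGadj : ((R.symm.toContinuousLinearEquiv.toContinuousLinearMap ∘L G w)†) y
      = ((G w)†) (R y) := by
    refine ext_inner_right ℂ fun v => ?_
    rw [adjoint_inner_left, adjoint_inner_left, ← R.inner_map_map]
    simp
  apply R.injective
  rw [map_sub, hRQ, hadj, h, hGadj, map_smul]
  simp

end SchurCriterion

/-! ### Coincidence and weak coincidence. -/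

section CoincideLemmas

variable {d : ℕ} {E₁ F₁ E₂ F₂ E₃ F₃ : Type*}
    [NormedAddCommGroup E₁] [InnerProductSpace ℂ E₁]
    [NormedAddCommGroup F₁] [InnerProductSpace ℂ F₁]
    [NormedAddCommGroup E₂] [InnerProductSpace ℂ E₂]
    [NormedAddCommGroup F₂] [InnerProductSpace ℂ F₂]
    [NormedAddCommGroup E₃] [InnerProductSpace ℂ E₃]
    [NormedAddCommGroup F₃] [InnerProductSpace ℂ F₃]

lemma Coincide.trans {b₁ : Ball d → E₁ →L[ℂ] F₁} {b₂ : Ball d → E₂ →L[ℂ] F₂}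
    {b₃ : Ball d → E₃ →L[ℂ] F₃} (h₁₂ : Coincide b₁ b₂) (h₂₃ : Coincide b₂ b₃) :
    Coincide b₁ b₃ := by
  obtain ⟨R, Q, h⟩ := h₁₂
  obtain ⟨R', Q', h'⟩ := h₂₃
  exact ⟨R.trans R', Q.trans Q', fun z x => by simp [h, h']⟩

variable [CompleteSpace E₁] [CompleteSpace F₁] [CompleteSpace E₂] [CompleteSpace F₂]

/-- From `Q b₁(z)* = b₂(z)* R`, the unitary `Q` carries the ranges of `b₁(z)*` onto those of
`b₂(z)*`. It therefore restricts to a unitary between the supports. -/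
lemma Coincide.coincideWeakly {b₁ : Ball d → E₁ →L[ℂ] F₁} {b₂ : Ball d → E₂ →L[ℂ] F₂}
    (h : Coincide b₁ b₂) : CoincideWeakly b₁ b₂ := by
  obtain ⟨R, Q, hRQ⟩ := h
  have hadj : ∀ z y, Q (((b₁ z)†) y) = ((b₂ z)†) (R y) := fun z y => by
    refine ext_inner_right ℂ fun v => ?_
    obtain ⟨x, rfl⟩ := Q.surjective v
    rw [LinearIsometryEquiv.inner_map_map, adjoint_inner_left, adjoint_inner_left, ← hRQ,
      LinearIsometryEquiv.inner_map_map]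
  have hmap : (support b₁).map (Q.toLinearEquiv : E₁ →ₗ[ℂ] E₂) = support b₂ := by
    have h1 : (⨆ z : Ball d, LinearMap.range ((b₁ z)†).toLinearMap).map
        (Q.toLinearEquiv : E₁ →ₗ[ℂ] E₂) =
        ⨆ z : Ball d, LinearMap.range ((b₂ z)†).toLinearMap := by
      rw [Submodule.map_iSup]
      congr 1
      ext z t
      simp only [Submodule.mem_map, LinearMap.mem_range]
      constructor
      · rintro ⟨_, ⟨y, rfl⟩, rfl⟩
        exact ⟨R y, (hadj z y).symm⟩
      · rintro ⟨y, rfl⟩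
        exact ⟨_, ⟨R.symm y, rfl⟩, (hadj z _).trans (by simp)⟩
    apply SetLike.coe_injective
    rw [support, support, ← h1]
    simp only [Submodule.map_coe, Submodule.topologicalClosure_coe]
    exact Q.toHomeomorph.image_closure _
  refine ⟨R, (Q.submoduleMap (support b₁)).trans (LinearIsometryEquiv.ofEq _ _ hmap),
    fun z x => ?_⟩
  exact hRQ z x

end CoincideLemmas

/-! ### Defect operators and defect spaces. -/

section DefectLemmas

variable {E F E' F' : Type*} [NormedAddCommGroup E] [InnerProductSpace ℂ E] [CompleteSpace E]
  [NormedAddCommGroup F] [InnerProductSpace ℂ F] [CompleteSpace F]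
  [NormedAddCommGroup E'] [InnerProductSpace ℂ E'] [CompleteSpace E']
  [NormedAddCommGroup F'] [InnerProductSpace ℂ F'] [CompleteSpace F']

lemma defect_adjoint (A : E →L[ℂ] F) : (defect A)† = defect A :=
  (IsSelfAdjoint.of_nonneg (defect_nonneg A)).star_eq

lemma defect_defect_apply (A : E →L[ℂ] F) (hA : ‖A‖ ≤ 1) (x : E) :
    defect A (defect A x) = x - (A†) (A x) := by
  simpa using DFunLike.congr_fun (defect_comp_defect A hA) x

lemma defect_adjoint_defect_adjoint_apply (A : E →L[ℂ] F) (hA : ‖A‖ ≤ 1) (y : F) :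
    defect (A†) (defect (A†) y) = y - A ((A†) y) := by
  simpa using defect_defect_apply (A†) (by simpa using hA) y

lemma apply_defect (A : E →L[ℂ] F) (hA : ‖A‖ ≤ 1) (x : E) :
    A (defect A x) = defect (A†) (A x) := DFunLike.congr_fun (comp_defect A hA) x

lemma adjoint_apply_defect_adjoint (A : E →L[ℂ] F) (hA : ‖A‖ ≤ 1) (y : F) :
    (A†) (defect (A†) y) = defect A ((A†) y) := by
  simpa using apply_defect (A†) (by simpa using hA) y

lemma defect_mem_defectSpace (A : E →L[ℂ] F) (x : E) : defect A x ∈ defectSpace A :=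
  Submodule.le_topologicalClosure _ ⟨x, rfl⟩

lemma adjoint_map_mem_defectSpace (A : E →L[ℂ] F) (hA : ‖A‖ ≤ 1) {y : F}
    (hy : y ∈ defectSpace (A†)) : (A†) y ∈ defectSpace A := by
  simpa using map_mem_defectSpace (A†) (by simpa using hA) hy

lemma ker_defect_orthogonal (A : E →L[ℂ] F) :
    (LinearMap.ker (defect A).toLinearMap)ᗮ = defectSpace A := by
  have := orthogonal_ker (defect A)
  rwa [defect_adjoint] at this

lemma defect_apply_eq_zero_of_norm_eq (A : E →L[ℂ] F) (hA : ‖A‖ ≤ 1) {x : E}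
    (hx : ‖A x‖ = ‖x‖) : defect A x = 0 := by
  have h1 : ⟪defect A x, defect A x⟫_ℂ = ⟪x, x⟫_ℂ - ⟪A x, A x⟫_ℂ := by
    have h2 := adjoint_inner_left (defect A) x (defect A x)
    rw [defect_adjoint, defect_defect_apply A hA, inner_sub_left, adjoint_inner_left] at h2
    exact h2.symm
  rw [inner_self_eq_norm_sq_to_K x, inner_self_eq_norm_sq_to_K (A x), hx, sub_self] at h1
  exact inner_self_eq_zero.1 h1

/-- An isometry `W` onto a subspace invariant under `D_A` intertwines the defect operators of
`A` and of its compression. -/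
lemma apply_defect_of_isometry (A : E →L[ℂ] F) (B : E' →L[ℂ] F') (hA : ‖A‖ ≤ 1)
    (W : E' →L[ℂ] E) (hW : W† ∘L W = 1)
    (hinv : ∀ x, W ((W†) (defect A (W x))) = defect A (W x))
    (hAB : ∀ x, W ((B†) (B x)) = (A†) (A (W x))) (x : E') :
    W (defect B x) = defect A (W x) := by
  have hW' : ∀ x, (W†) (W x) = x := fun x => by simpa using DFunLike.congr_fun hW x
  have key : W† ∘L defect A ∘L W = defect B := by
    -- The compression `W* D_A W` is nonnegative, and by invariance its square is `W*(I - A* A)W = I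
    -- - B* B`.
    refine (CFC.sqrt_unique ?_ ?_).symm
    · ext x
      simp only [mul_apply_eq_comp, comp_apply, hinv, defect_defect_apply A hA, map_sub, hW',
        ← hAB]
      simp
    · have h0 := defect_nonneg A
      rw [nonneg_iff_isPositive] at h0 ⊢
      exact h0.adjoint_conj W
  rw [← key]
  exact hinv x

end DefectLemmas

/-! ### Row operators, resolvents and the kernel identity for `Θ_T`. -/

section RowLemmas

variable {d : ℕ} {H : Type*} [NormedAddCommGroup H] [InnerProductSpace ℂ H] [CompleteSpace H]

lemma rowOp_apply {E : Type*} [NormedAddCommGroup E] [InnerProductSpace ℂ E] [CompleteSpace E]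
    (z : Ball d) (h : Copies d E) :
    rowOp E z h = ∑ i, (z : EuclideanSpace ℂ (Fin d)) i • h i := by
  simp [rowOp]

lemma norm_rowOp_apply_le (z : Ball d) (h : Copies d H) :
    ‖rowOp H z h‖ ≤ ‖(z : EuclideanSpace ℂ (Fin d))‖ * ‖h‖ := by
  rw [rowOp_apply, EuclideanSpace.norm_eq, PiLp.norm_eq_of_L2]
  calc _ ≤ ∑ i, ‖(z : EuclideanSpace ℂ (Fin d)) i‖ * ‖h i‖ :=
        (norm_sum_le _ _).trans_eq (by simp [norm_smul])
    _ ≤ _ := Real.sum_mul_le_sqrt_mul_sqrt _ _ _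

lemma norm_rowOp_lt_one (z : Ball d) : ‖rowOp H z‖ < 1 :=
  (opNorm_le_bound _ (norm_nonneg _) (norm_rowOp_apply_le z)).trans_lt
    (by exact mem_ball_zero_iff.1 z.2)

lemma rowOp_comp_adjoint_apply (z w : Ball d) (h : H) :
    rowOp H z (((rowOp H w)†) h) = ⟪(w : EuclideanSpace ℂ (Fin d)), z⟫_ℂ • h := by
  refine ext_inner_left ℂ fun v => ?_
  rw [← adjoint_inner_left, adjoint_inner_right]
  have hadj : ∀ i, (((rowOp H z)†) v) i
      = (starRingEnd ℂ) ((z : EuclideanSpace ℂ (Fin d)) i) • v := fun i => by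
    refine ext_inner_right ℂ fun u => ?_
    have h1 := adjoint_inner_left (rowOp H z) (PiLp.single 2 i u) v
    rw [PiLp.inner_apply, rowOp_apply, Finset.sum_eq_single i, Finset.sum_eq_single i] at h1
    · simpa [inner_smul_right, inner_smul_left] using h1
    all_goals simp +contextual
  rw [rowOp_apply, sum_inner, PiLp.inner_apply, Finset.sum_smul, inner_sum]
  refine Finset.sum_congr rfl fun i _ => ?_
  rw [hadj]
  simp [inner_smul_left, inner_smul_right]
  ring

lemma isUnit_one_sub_rowOp_comp_adjoint (A : Copies d H →L[ℂ] H) (hA : ‖A‖ ≤ 1) (z : Ball d) :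
    IsUnit (1 - rowOp H z ∘L A†) := by
  refine isUnit_one_sub_of_norm_lt_one ?_
  calc ‖rowOp H z ∘L A†‖ ≤ ‖rowOp H z‖ * ‖A†‖ := opNorm_comp_le _ _
    _ ≤ ‖rowOp H z‖ * 1 := by gcongr; simpa using hA
    _ < 1 := by simpa using norm_rowOp_lt_one z

/-- The resolvent `(I - z A*)⁻¹`. -/
noncomputable def rowResolvent (A : Copies d H →L[ℂ] H) (z : Ball d) : H →L[ℂ] H :=
  Ring.inverse (1 - rowOp H z ∘L A†)

lemma rowResolvent_apply_sub (A : Copies d H →L[ℂ] H) (hA : ‖A‖ ≤ 1) (z : Ball d) (u : H) :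
    rowResolvent A z (u - rowOp H z ((A†) u)) = u := by
  simpa [rowResolvent] using DFunLike.congr_fun
    (Ring.inverse_mul_cancel _ (isUnit_one_sub_rowOp_comp_adjoint A hA z)) u

lemma rowResolvent_apply (A : Copies d H →L[ℂ] H) (hA : ‖A‖ ≤ 1) (z : Ball d) (u : H) :
    rowResolvent A z u - rowOp H z ((A†) (rowResolvent A z u)) = u := by
  simpa [rowResolvent] using DFunLike.congr_fun
    (Ring.mul_inverse_cancel _ (isUnit_one_sub_rowOp_comp_adjoint A hA z)) u

lemma nagyFoiasAux_apply (T : Copies d H →L[ℂ] H) (z : Ball d) (x : Copies d H) :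
    nagyFoiasAux T z x =
      -T x + defect (T†) (rowResolvent T z (rowOp H z (defect T x))) := by
  simp [nagyFoiasAux, rowResolvent]

lemma adjoint_nagyFoiasAux_apply (T : Copies d H →L[ℂ] H) (w : Ball d) (y : H) :
    ((nagyFoiasAux T w)†) y = -(T†) y +
      defect T (((rowOp H w)†) (((rowResolvent T w)†) (defect (T†) y))) := by
  refine ext_inner_right ℂ fun x => ?_
  rw [adjoint_inner_left, nagyFoiasAux_apply]
  simp only [inner_add_left, inner_add_right, inner_neg_left, inner_neg_right,
    adjoint_inner_left]
  congr 1
  rw [← adjoint_inner_left, defect_adjoint]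
  conv_rhs => rw [← adjoint_inner_right, defect_adjoint, adjoint_inner_left, adjoint_inner_left]

/-- `I - Θ(z) Θ(w)* = (1 - z w*) D_{T*} (I - z T*)⁻¹ (I - T w*)⁻¹ D_{T*}`. -/
lemma sub_nagyFoiasAux_adjoint (T : Copies d H →L[ℂ] H) (hT : ‖T‖ ≤ 1) (z w : Ball d) (y : H) :
    y - nagyFoiasAux T z (((nagyFoiasAux T w)†) y) =
      (1 - ⟪(w : EuclideanSpace ℂ (Fin d)), z⟫_ℂ) •
        defect (T†) (rowResolvent T z (((rowResolvent T w)†) (defect (T†) y))) := by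
  set p := ((rowResolvent T w)†) (defect (T†) y) with hp
  set q := ((rowOp H w)†) p with hq
  have hpy : defect (T†) y = p - T q := by
    refine ext_inner_right ℂ fun v => ?_
    conv_lhs => rw [← rowResolvent_apply_sub T hT w v]
    rw [← adjoint_inner_left, ← hp, inner_sub_right, inner_sub_left, hq,
      ← adjoint_inner_left (rowOp H w), ← adjoint_inner_right T]
  -- By intertwining, `D_T(-T* y + D_T q) = -T*(p - T q) + q - T* T q = q - T* p`; then `z q = (z
  -- w*) p`.
  have h1 : rowOp H z (defect T (-(T†) y + defect T q)) =
      ⟪(w : EuclideanSpace ℂ (Fin d)), z⟫_ℂ • p - rowOp H z ((T†) p) := by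
    rw [map_add, map_neg, ← adjoint_apply_defect_adjoint T hT, defect_defect_apply T hT, hpy,
      ← rowOp_comp_adjoint_apply, ← hq]
    simp only [map_add, map_neg, map_sub]
    abel
  -- The argument equals `(I - z T*) p - (1 - z w*) p`.
  have h2 : rowResolvent T z (⟪(w : EuclideanSpace ℂ (Fin d)), z⟫_ℂ • p - rowOp H z ((T†) p)) =
      p - (1 - ⟪(w : EuclideanSpace ℂ (Fin d)), z⟫_ℂ) • rowResolvent T z p := by
    have h3 := rowResolvent_apply_sub T hT z p
    rw [map_sub, map_smul, sub_smul, one_smul]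
    rw [map_sub] at h3
    nth_rw 3 [← h3]
    abel
  have h4 := defect_adjoint_defect_adjoint_apply T hT y
  rw [hpy, map_sub] at h4
  rw [adjoint_nagyFoiasAux_apply, ← hp, ← hq, nagyFoiasAux_apply, h1, h2, map_add, map_neg,
    apply_defect T hT, map_sub, map_smul]
  have h5 : defect (T†) (T q) = defect (T†) p - (y - T ((T†) y)) := by rw [← h4]; abel
  rw [h5]
  abel

lemma adjoint_nagyFoiasAux_mem (T : Copies d H →L[ℂ] H) (hT : ‖T‖ ≤ 1) (z : Ball d)
    {y : H} (hy : y ∈ defectSpace (T†)) : ((nagyFoiasAux T z)†) y ∈ defectSpace T := by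
  rw [adjoint_nagyFoiasAux_apply]
  exact Submodule.add_mem _ (Submodule.neg_mem _ (adjoint_map_mem_defectSpace T hT hy))
    (defect_mem_defectSpace T _)

lemma coe_nagyFoias_apply (T : Copies d H →L[ℂ] H) (hT : ‖T‖ ≤ 1) (z : Ball d)
    (x : defectSpace T) : (nagyFoias T hT z x : H) = nagyFoiasAux T z x := rfl

lemma coe_adjoint_nagyFoias_apply (T : Copies d H →L[ℂ] H) (hT : ‖T‖ ≤ 1) (z : Ball d)
    (y : defectSpace (T†)) :
    (((nagyFoias T hT z)†) y : Copies d H) = ((nagyFoiasAux T z)†) y := by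
  have h : ((nagyFoias T hT z)†) y =
      ⟨((nagyFoiasAux T z)†) y, adjoint_nagyFoiasAux_mem T hT z y.2⟩ := by
    refine ext_inner_right ℂ fun x => ?_
    rw [adjoint_inner_left, Submodule.coe_inner, Submodule.coe_inner, coe_nagyFoias_apply,
      adjoint_inner_left]
  rw [h]

/-- The operator `D_{T*} (I - z T*)⁻¹`, with values in the defect space of `T*`. -/
noncomputable def nagyFoiasFactor (T : Copies d H →L[ℂ] H) (z : Ball d) :
    H →L[ℂ] defectSpace (T†) :=
  (defect (T†) ∘L rowResolvent T z).codRestrict (defectSpace (T†))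
    fun x => defect_mem_defectSpace (T†) (rowResolvent T z x)

lemma coe_nagyFoiasFactor_apply (T : Copies d H →L[ℂ] H) (z : Ball d) (x : H) :
    (nagyFoiasFactor T z x : H) = defect (T†) (rowResolvent T z x) := rfl

lemma adjoint_nagyFoiasFactor_apply (T : Copies d H →L[ℂ] H) (z : Ball d)
    (y : defectSpace (T†)) :
    ((nagyFoiasFactor T z)†) y = ((rowResolvent T z)†) (defect (T†) y) := by
  refine ext_inner_right ℂ fun v => ?_
  rw [adjoint_inner_left, adjoint_inner_left, Submodule.coe_inner, coe_nagyFoiasFactor_apply,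
    ← adjoint_inner_left, defect_adjoint]

/-- The kernel factorization of the Sz.-Nagy–Foiaş characteristic function. -/
lemma nagyFoias_factorization (T : Copies d H →L[ℂ] H) (hT : ‖T‖ ≤ 1) (z w : Ball d)
    (y : defectSpace (T†)) :
    y - nagyFoias T hT z (((nagyFoias T hT w)†) y) =
      (1 - ⟪(w : EuclideanSpace ℂ (Fin d)), z⟫_ℂ) •
        nagyFoiasFactor T z (((nagyFoiasFactor T w)†) y) := by
  apply Subtype.ext
  rw [adjoint_nagyFoiasFactor_apply, Submodule.coe_sub, coe_nagyFoias_apply,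
    coe_adjoint_nagyFoias_apply, sub_nagyFoiasAux_adjoint T hT, Submodule.coe_smul,
    coe_nagyFoiasFactor_apply]

/-! ### The partial isometric part -/

section IsometricPart

variable (T : Copies d H →L[ℂ] H) (hT : ‖T‖ ≤ 1)

include hT in
lemma norm_isometricPart_le : ‖isometricPart T‖ ≤ 1 := by
  calc ‖isometricPart T‖ ≤ ‖T‖ * ‖(LinearMap.ker (defect T).toLinearMap).starProjection‖ :=
        opNorm_comp_le _ _
    _ ≤ 1 * 1 := by gcongr; exact Submodule.starProjection_norm_le _
    _ = 1 := one_mul 1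

lemma isometricPart_apply (x : Copies d H) : isometricPart T x =
    T ((LinearMap.ker (defect T).toLinearMap).starProjection x) := rfl

lemma adjoint_isometricPart_apply (y : H) : ((isometricPart T)†) y =
    (LinearMap.ker (defect T).toLinearMap).starProjection ((T†) y) := by
  refine ext_inner_right ℂ fun x => ?_
  rw [adjoint_inner_left, isometricPart_apply, ← adjoint_inner_left,
    Submodule.inner_starProjection_left_eq_right]

include hT in
lemma adjoint_apply_isometricPart (x : Copies d H) : (T†) (isometricPart T x) =
    (LinearMap.ker (defect T).toLinearMap).starProjection x := by
  have h1 : defect T ((LinearMap.ker (defect T).toLinearMap).starProjection x) = 0 :=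
    LinearMap.mem_ker.1
      (Submodule.starProjection_apply_mem (LinearMap.ker (defect T).toLinearMap) x)
  have h2 := defect_defect_apply T hT
    ((LinearMap.ker (defect T).toLinearMap).starProjection x)
  rw [h1, map_zero] at h2
  rw [isometricPart_apply]
  exact (sub_eq_zero.1 h2.symm).symm

lemma starProjection_adjoint_isometricPart (y : H) :
    (LinearMap.ker (defect T).toLinearMap).starProjection (((isometricPart T)†) y) =
      ((isometricPart T)†) y := by
  rw [adjoint_isometricPart_apply, Submodule.starProjection_eq_self_iff]
  exact Submodule.starProjection_apply_mem _ _

lemma isometricPart_adjoint_isometricPart (y : H) :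
    isometricPart T (((isometricPart T)†) y) = T (((isometricPart T)†) y) := by
  rw [isometricPart_apply, starProjection_adjoint_isometricPart]

include hT in
lemma adjoint_isometricPart_isometricPart (x : Copies d H) :
    ((isometricPart T)†) (isometricPart T x) =
      (LinearMap.ker (defect T).toLinearMap).starProjection x := by
  rw [adjoint_isometricPart_apply, adjoint_apply_isometricPart T hT,
    Submodule.starProjection_eq_self_iff]
  exact Submodule.starProjection_apply_mem _ _

include hT in
lemma isometricPart_adjoint_isometricPart_isometricPart (x : Copies d H) :
    isometricPart T (((isometricPart T)†) (isometricPart T x)) = isometricPart T x := by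
  rw [isometricPart_adjoint_isometricPart, adjoint_isometricPart_isometricPart T hT]
  rfl

include hT in
lemma adjoint_isometricPart_isometricPart_adjoint (y : H) :
    ((isometricPart T)†) (isometricPart T (((isometricPart T)†) y)) =
      ((isometricPart T)†) y := by
  rw [adjoint_isometricPart_isometricPart T hT, starProjection_adjoint_isometricPart]

include hT in
lemma adjoint_apply_isometricPart_adjoint (y : H) :
    (T†) (isometricPart T (((isometricPart T)†) y)) = ((isometricPart T)†) y := by
  rw [adjoint_apply_isometricPart T hT, starProjection_adjoint_isometricPart]

include hT in
-- `V* V` is the projection onto `ker D_T`, so `V` vanishes exactly on its orthogonal complement.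
lemma ker_isometricPart : LinearMap.ker (isometricPart T).toLinearMap = defectSpace T := by
  rw [← ker_defect_orthogonal]
  ext x
  rw [LinearMap.mem_ker, ← Submodule.starProjection_apply_eq_zero_iff]
  constructor
  · intro h
    rw [← adjoint_isometricPart_isometricPart T hT]
    exact (congrArg _ h).trans (map_zero _)
  · intro h
    exact (congrArg T h).trans (map_zero _)

include hT in
-- As `V* = P_{ker D_T} T*`, the condition `V* y = 0` says that `T* y` lies in the defect space of
-- `T`. Then `y = D_{T*}² y + T T* y` has both terms in the defect space of `T*`.
lemma ker_adjoint_isometricPart :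
    LinearMap.ker ((isometricPart T)†).toLinearMap = defectSpace (T†) := by
  have h0 : ∀ y, ((isometricPart T)†) y = 0 ↔ (T†) y ∈ defectSpace T := fun y => by
    rw [← ker_defect_orthogonal, ← Submodule.starProjection_apply_eq_zero_iff,
      adjoint_isometricPart_apply]
  ext y
  refine (h0 y).trans ⟨fun h => ?_, adjoint_map_mem_defectSpace T hT⟩
  have h1 := defect_adjoint_defect_adjoint_apply T hT y
  rw [eq_sub_iff_add_eq] at h1
  rw [← h1]
  exact Submodule.add_mem _ (defect_mem_defectSpace _ _) (map_mem_defectSpace T hT h)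

lemma rowOp_origin (h : Copies d H) : rowOp H (Ball.origin d) h = 0 := by
  simp [rowOp_apply, Ball.origin]

include hT in
lemma restrictedRange_origin_orthogonal :
    (restrictedRange (isometricPart T) (Ball.origin d))ᗮ = defectSpace (T†) := by
  rw [← ker_adjoint_isometricPart T hT, ← orthogonal_range]
  congr 1
  ext y
  simp only [restrictedRange, LinearMap.mem_range, coe_coe, comp_apply, sub_apply, rowOp_origin,
    sub_zero, isometricPart_adjoint_isometricPart_isometricPart T hT]

include hT in
/-- The operator `(I - V z*)⁻¹` maps `(ran V)ᗮ` into `ran ((V - z) V* V)ᗮ`. -/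
lemma adjoint_rowResolvent_mem (z : Ball d) {y : H}
    (hy : ((isometricPart T)†) y = 0) :
    ((rowResolvent (isometricPart T) z)†) y ∈ (restrictedRange (isometricPart T) z)ᗮ := by
  rw [Submodule.mem_orthogonal]
  rintro _ ⟨x, rfl⟩
  rw [adjoint_inner_right]
  have h := rowResolvent_apply_sub (isometricPart T) (norm_isometricPart_le T hT) z
    (isometricPart T x)
  -- Since `(V - z) V* V = (I - z V*) V`, the resolvent returns the restricted range to `ran V`.
  have h1 : rowResolvent (isometricPart T) z (((isometricPart T - rowOp H z) ∘L
      (isometricPart T)† ∘L isometricPart T) x) = isometricPart T x := by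
    simp only [comp_apply, sub_apply, isometricPart_adjoint_isometricPart_isometricPart T hT, h]
  rw [coe_coe, h1, ← adjoint_inner_right, hy, inner_zero_right]

include hT in
/-- The part of the computation of the inverse Frostman transform that takes place in `H`. -/
lemma defect_adjoint_nagyFoiasAux {z : Ball d} {u : H} {w x : Copies d H}
    (hu : u = rowOp H z (w + ((isometricPart T)†) u))
    (hw : w - (T†) (u - isometricPart T (((isometricPart T)†) u)) = defect T x) :
    defect (T†) (nagyFoiasAux T z x) =
      u - isometricPart T (((isometricPart T)†) u) - T w := by
  rw [map_sub, adjoint_apply_isometricPart_adjoint T hT] at hw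
  have hw' : w + ((isometricPart T)†) u = defect T x + (T†) u := by rw [← hw]; abel
  -- Substituting `w + V* u = D_T x + T* u` turns the equation for `u` in terms of `V` into `(I - z
  -- T*) u = z D_T x`.
  have hR : rowResolvent T z (rowOp H z (defect T x)) = u := by
    rw [← rowResolvent_apply_sub T hT z u]
    congr 2
    rw [hw', map_add] at hu
    exact (sub_eq_of_eq_add hu).symm
  rw [nagyFoiasAux_apply, hR, map_add, map_neg, ← apply_defect T hT,
    defect_adjoint_defect_adjoint_apply T hT, isometricPart_adjoint_isometricPart]
  have h3 : T w = T (defect T x) + T ((T†) u) - T (((isometricPart T)†) u) := by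
    rw [← map_add, ← hw', map_add, add_sub_cancel_right]
  rw [h3]
  abel

end IsometricPart

end RowLemmas

/-! ### Model maps and their adjoints. -/

namespace ModelTriple

variable {d : ℕ} {H Jinf J₀ : Type*} [NormedAddCommGroup H] [InnerProductSpace ℂ H]
  [CompleteSpace H]
  [NormedAddCommGroup Jinf] [InnerProductSpace ℂ Jinf]
  [NormedAddCommGroup J₀] [InnerProductSpace ℂ J₀]

section General

variable {V : Copies d H →L[ℂ] H} (γ : ModelTriple V Jinf J₀)

lemma toH_mem (z : Ball d) (j : J₀) : γ.toH z j ∈ (restrictedRange V z)ᗮ := (γ.equiv z j).2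

lemma exists_toH_eq (z : Ball d) {y : H} (hy : y ∈ (restrictedRange V z)ᗮ) :
    ∃ j, γ.toH z j = y :=
  ⟨(γ.equiv z).symm ⟨y, hy⟩, congrArg Subtype.val ((γ.equiv z).apply_symm_apply ⟨y, hy⟩)⟩

lemma norm_toH_origin (j : J₀) : ‖γ.toH (Ball.origin d) j‖ = ‖j‖ := γ.norm_equiv_origin j

lemma norm_inf (x : Jinf) : ‖γ.inf x‖ = ‖x‖ := γ.equivInf.norm_map x

lemma inf_mem (x : Jinf) : V (γ.inf x) = 0 := (γ.equivInf x).2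

lemma exists_inf_eq {x : Copies d H} (hx : V x = 0) : ∃ j, γ.inf j = x :=
  ⟨γ.equivInf.symm ⟨x, hx⟩, congrArg Subtype.val (γ.equivInf.apply_symm_apply ⟨x, hx⟩)⟩

section

variable [CompleteSpace Jinf]

lemma adjoint_inf_comp_inf : (γ.inf)† ∘L γ.inf = 1 :=
  (norm_map_iff_adjoint_comp_self _).1 γ.norm_inf

lemma adjoint_inf_inf (x : Jinf) : ((γ.inf)†) (γ.inf x) = x :=
  DFunLike.congr_fun γ.adjoint_inf_comp_inf x

end

variable [CompleteSpace J₀]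

lemma adjoint_toH_comp_toH_origin :
    (γ.toH (Ball.origin d))† ∘L γ.toH (Ball.origin d) = 1 :=
  (norm_map_iff_adjoint_comp_self _).1 γ.norm_toH_origin

lemma adjoint_toH_toH_origin (j : J₀) :
    ((γ.toH (Ball.origin d))†) (γ.toH (Ball.origin d) j) = j :=
  DFunLike.congr_fun γ.adjoint_toH_comp_toH_origin j

lemma adjoint_toH_apply_eq_zero (z : Ball d) {h : H} (hh : h ∈ restrictedRange V z) :
    ((γ.toH z)†) h = 0 := by
  refine ext_inner_right ℂ fun j => ?_
  rw [adjoint_inner_left, inner_zero_left]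
  exact Submodule.inner_right_of_mem_orthogonal hh (γ.toH_mem z j)

lemma adjoint_toH_surjective (z : Ball d) : Function.Surjective ((γ.toH z)†) := by
  intro t
  refine ⟨((((γ.equiv z).symm.toContinuousLinearMap)†) t : (restrictedRange V z)ᗮ), ?_⟩
  refine ext_inner_right ℂ fun j => ?_
  rw [adjoint_inner_left]
  change ⟪(((γ.equiv z).symm.toContinuousLinearMap)†) t, γ.equiv z j⟫_ℂ = _
  rw [adjoint_inner_left]
  simp

lemma rowOp_numerator (z : Ball d) (x : Jinf) :
    rowOp J₀ z (γ.numerator z x) = ((γ.toH z)†) (rowOp H z (γ.inf x)) := by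
  rw [rowOp_apply, rowOp_apply, map_sum]
  simp [numerator, ampliate]

end General

/-! ### Evaluation of `b_V` and `b_T`. -/

section CharFun

variable {T : Copies d H →L[ℂ] H} (hT : ‖T‖ ≤ 1) (γ : ModelTriple (isometricPart T) Jinf J₀)

include hT

lemma toH_origin_mem (j : J₀) : γ.toH (Ball.origin d) j ∈ defectSpace (T†) := by
  rw [← restrictedRange_origin_orthogonal T hT]
  exact γ.toH_mem _ j

lemma adjoint_isometricPart_toH_origin (j : J₀) :
    ((isometricPart T)†) (γ.toH (Ball.origin d) j) = 0 := by
  have h := γ.toH_origin_mem hT j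
  rw [← ker_adjoint_isometricPart T hT] at h
  exact h

lemma inf_mem_defectSpace (x : Jinf) : γ.inf x ∈ defectSpace T := by
  rw [← ker_isometricPart T hT]
  exact γ.inf_mem x

section

variable [CompleteSpace Jinf]

lemma inf_adjoint_inf {x : Copies d H} (hx : x ∈ defectSpace T) :
    γ.inf (((γ.inf)†) x) = x := by
  rw [← ker_isometricPart T hT] at hx
  obtain ⟨j, rfl⟩ := γ.exists_inf_eq hx
  rw [adjoint_inf_inf]

end

variable [CompleteSpace J₀]

lemma toH_adjoint_toH_origin {y : H} (hy : y ∈ defectSpace (T†)) :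
    γ.toH (Ball.origin d) (((γ.toH (Ball.origin d))†) y) = y := by
  rw [← restrictedRange_origin_orthogonal T hT] at hy
  obtain ⟨j, rfl⟩ := γ.exists_toH_eq _ hy
  rw [adjoint_toH_toH_origin]

/-- The decomposition `H = ran V ᗮ + ran ((V - z) V* V)`, and its image under `γ(z)*`. -/
lemma exists_toH_origin_eq (z : Ball d) (h : H) :
    ∃ j, γ.toH (Ball.origin d) j =
        rowResolvent (isometricPart T) z h - isometricPart T
          (((isometricPart T)†) (rowResolvent (isometricPart T) z h)) ∧
      γ.denominator z j = ((γ.toH z)†) h := by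
  have hu := rowResolvent_apply (isometricPart T) (norm_isometricPart_le T hT) z h
  set u := rowResolvent (isometricPart T) z h with hu'
  have hmem : u - isometricPart T (((isometricPart T)†) u) ∈
      (restrictedRange (isometricPart T) (Ball.origin d))ᗮ := by
    rw [restrictedRange_origin_orthogonal T hT, ← ker_adjoint_isometricPart T hT,
      LinearMap.mem_ker, coe_coe, map_sub,
      adjoint_isometricPart_isometricPart_adjoint T hT, sub_self]
  obtain ⟨j, hj⟩ := γ.exists_toH_eq _ hmem
  refine ⟨j, hj, ?_⟩
  rw [denominator, comp_apply, hj, ← sub_eq_zero, ← map_sub]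
  apply adjoint_toH_apply_eq_zero
  -- With `h = u - z V* u`, the difference `(u - V V* u) - h` is `(V - z)(-V* u)`, and `V* V` fixes
  -- `V* u`.
  refine ⟨-((isometricPart T)†) u, ?_⟩
  simp only [coe_coe, comp_apply, map_neg, adjoint_isometricPart_isometricPart_adjoint T hT,
    sub_apply]
  rw [eq_sub_of_add_eq' (sub_eq_iff_eq_add.1 hu).symm]
  abel

/-- Surjectivity comes from the decomposition of `H` above. For injectivity, a vector `y` of `(ran
V)ᗮ` is fixed by `(I - z V*)⁻¹`, whose adjoint sends `y` into `ran γ(z)`; so `γ(z)* y = 0` forces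
`⟪y, y⟫ = 0`. -/
lemma isUnit_denominator (z : Ball d) : IsUnit (γ.denominator z) := by
  rw [isUnit_iff_bijective]
  refine ⟨(injective_iff_map_eq_zero _).2 fun j hj => ?_, fun t => ?_⟩
  · set y := γ.toH (Ball.origin d) j with hy
    have hVy : ((isometricPart T)†) y = 0 := γ.adjoint_isometricPart_toH_origin hT j
    obtain ⟨k, hk⟩ := γ.exists_toH_eq z (adjoint_rowResolvent_mem T hT z hVy)
    have hRy : rowResolvent (isometricPart T) z y = y := by
      simpa [hVy] using
        rowResolvent_apply_sub (isometricPart T) (norm_isometricPart_le T hT) z y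
    have hjy : ((γ.toH z)†) y = 0 := hj
    have h1 : ⟪y, y⟫_ℂ = 0 := by
      nth_rw 2 [← hRy]
      rw [← adjoint_inner_left, ← hk, ← adjoint_inner_right, hjy, inner_zero_right]
    rw [inner_self_eq_zero] at h1
    rw [← norm_eq_zero, ← γ.norm_toH_origin, ← hy, h1, norm_zero]
  · obtain ⟨h, rfl⟩ := γ.adjoint_toH_surjective z t
    obtain ⟨j, -, hj⟩ := γ.exists_toH_origin_eq hT z h
    exact ⟨j, hj⟩

lemma toH_charFunIsometric (z : Ball d) (x : Jinf) :
    γ.toH (Ball.origin d) (γ.charFunIsometric z x) =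
      rowResolvent (isometricPart T) z (rowOp H z (γ.inf x)) - isometricPart T
        (((isometricPart T)†) (rowResolvent (isometricPart T) z (rowOp H z (γ.inf x)))) := by
  obtain ⟨j, hj, hj'⟩ := γ.exists_toH_origin_eq hT z (rowOp H z (γ.inf x))
  have h : γ.charFunIsometric z x = j := by
    rw [charFunIsometric, comp_apply, comp_apply, rowOp_numerator, ← hj']
    exact DFunLike.congr_fun (Ring.inverse_mul_cancel _ (γ.isUnit_denominator hT z)) j
  rw [h, hj]

/-- An energy balance gives the bound `‖z‖`. With `x` in `ker V`, `u = z(x + v)` and `v = V* u`,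
orthogonality gives `‖u‖² ≤ ‖z‖²(‖x‖² + ‖v‖²)`, while `‖u‖² = ‖u - V v‖² + ‖v‖²`. -/
lemma norm_charFunIsometric_lt_one (z : Ball d) : ‖γ.charFunIsometric z‖ < 1 := by
  have hz : ‖(z : EuclideanSpace ℂ (Fin d))‖ < 1 := by exact mem_ball_zero_iff.1 z.2
  refine (opNorm_le_bound _ (norm_nonneg _) fun x => ?_).trans_lt hz
  rw [← γ.norm_toH_origin, toH_charFunIsometric hT, ← γ.norm_inf x]
  have hu := rowResolvent_apply (isometricPart T) (norm_isometricPart_le T hT) z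
    (rowOp H z (γ.inf x))
  set u := rowResolvent (isometricPart T) z (rowOp H z (γ.inf x))
  set v := ((isometricPart T)†) u with hv
  set r := ‖(z : EuclideanSpace ℂ (Fin d))‖
  have hu1 : u = rowOp H z (γ.inf x + v) := by
    rw [map_add, ← hu, sub_add_cancel]
  have hu2 : ‖u‖ ≤ r * ‖γ.inf x + v‖ := by
    nth_rw 1 [hu1]
    exact norm_rowOp_apply_le z _
  have hxv : ‖γ.inf x + v‖ * ‖γ.inf x + v‖ = ‖γ.inf x‖ * ‖γ.inf x‖ + ‖v‖ * ‖v‖ := by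
    apply norm_add_sq_eq_norm_sq_add_norm_sq_of_inner_eq_zero (𝕜 := ℂ)
    rw [hv, adjoint_inner_right, γ.inf_mem, inner_zero_left]
  have hVv : ((isometricPart T)†) (isometricPart T v) = v :=
    adjoint_isometricPart_isometricPart_adjoint T hT u
  have hVn : ‖isometricPart T v‖ = ‖v‖ := by
    have h1 : ⟪isometricPart T v, isometricPart T v⟫_ℂ = ⟪v, v⟫_ℂ := by
      rw [← adjoint_inner_left, hVv]
    rw [inner_self_eq_norm_sq_to_K, inner_self_eq_norm_sq_to_K] at h1
    have h2 : ‖isometricPart T v‖ ^ 2 = ‖v‖ ^ 2 := by exact_mod_cast h1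
    exact (sq_eq_sq₀ (norm_nonneg _) (norm_nonneg _)).1 h2
  have hdec : ‖u‖ * ‖u‖ = ‖u - isometricPart T v‖ * ‖u - isometricPart T v‖ +
      ‖isometricPart T v‖ * ‖isometricPart T v‖ := by
    rw [← norm_add_sq_eq_norm_sq_add_norm_sq_of_inner_eq_zero (𝕜 := ℂ), sub_add_cancel]
    rw [← adjoint_inner_left, map_sub, hVv, ← hv, sub_self, inner_zero_left]
  have hr : 0 ≤ r := norm_nonneg _
  have h3 : ‖u‖ * ‖u‖ ≤ r ^ 2 * (‖γ.inf x‖ * ‖γ.inf x‖ + ‖v‖ * ‖v‖) := by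
    rw [← hxv]
    calc ‖u‖ * ‖u‖ ≤ (r * ‖γ.inf x + v‖) * (r * ‖γ.inf x + v‖) := by gcongr
      _ = _ := by ring
  have h4 : r ^ 2 * (‖v‖ * ‖v‖) ≤ ‖v‖ * ‖v‖ :=
    mul_le_of_le_one_left (by positivity) (by nlinarith)
  rw [hVn] at hdec
  refine (sq_le_sq₀ (norm_nonneg _) (by positivity)).1 ?_
  nlinarith

lemma toH_zeroPoint (x : Jinf) :
    γ.toH (Ball.origin d) (γ.zeroPoint T x) = -T (γ.inf x) := by
  rw [zeroPoint, neg_apply, map_neg, comp_apply, comp_apply, toH_adjoint_toH_origin hT]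
  exact map_mem_defectSpace T hT (γ.inf_mem_defectSpace hT x)

lemma norm_zeroPoint_apply (x : Jinf) : ‖γ.zeroPoint T x‖ = ‖T (γ.inf x)‖ := by
  rw [← γ.norm_toH_origin, toH_zeroPoint hT, norm_neg]

lemma norm_zeroPoint_le : ‖γ.zeroPoint T‖ ≤ 1 := by
  refine opNorm_le_bound _ zero_le_one fun x => ?_
  rw [norm_zeroPoint_apply hT, ← γ.norm_inf x]
  exact T.le_of_opNorm_le hT _

/-- A vector of the defect space of `T` whose norm `T` preserves lies in `ker D_T` and in its
orthogonal complement. -/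
lemma isPureContraction_zeroPoint : IsPureContraction (γ.zeroPoint T) := by
  intro x hx
  rw [norm_zeroPoint_apply hT, ← γ.norm_inf x]
  refine lt_of_le_of_ne (by simpa using T.le_of_opNorm_le hT (γ.inf x)) fun h => hx ?_
  have h1 := defect_apply_eq_zero_of_norm_eq T hT h
  have h2 := γ.inf_mem_defectSpace hT x
  rw [← ker_defect_orthogonal] at h2
  have h3 : ⟪γ.inf x, γ.inf x⟫_ℂ = 0 :=
    Submodule.inner_right_of_mem_orthogonal (LinearMap.mem_ker.2 h1) h2
  rw [inner_self_eq_zero] at h3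
  rw [← norm_eq_zero, ← γ.norm_inf, h3, norm_zero]

variable [CompleteSpace Jinf]

lemma inf_adjoint_zeroPoint (j : J₀) :
    γ.inf (((γ.zeroPoint T)†) j) = -(T†) (γ.toH (Ball.origin d) j) := by
  have h : ((γ.zeroPoint T)†) j = -((γ.inf)†) ((T†) (γ.toH (Ball.origin d) j)) := by
    refine ext_inner_right ℂ fun x => ?_
    rw [adjoint_inner_left, inner_neg_left, adjoint_inner_left, adjoint_inner_left, zeroPoint,
      neg_apply, inner_neg_right, comp_apply, adjoint_inner_right, comp_apply]
  rw [h, map_neg, inf_adjoint_inf hT]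
  exact adjoint_map_mem_defectSpace T hT (γ.toH_origin_mem hT j)

lemma inf_defect_zeroPoint (x : Jinf) :
    γ.inf (defect (γ.zeroPoint T) x) = defect T (γ.inf x) := by
  refine apply_defect_of_isometry T _ hT γ.inf γ.adjoint_inf_comp_inf (fun x => ?_)
    (fun x => ?_) x
  · exact γ.inf_adjoint_inf hT (defect_mem_defectSpace T _)
  · rw [inf_adjoint_zeroPoint hT, toH_zeroPoint hT, map_neg, neg_neg]

lemma toH_defect_adjoint_zeroPoint (j : J₀) :
    γ.toH (Ball.origin d) (defect ((γ.zeroPoint T)†) j) =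
      defect (T†) (γ.toH (Ball.origin d) j) := by
  refine apply_defect_of_isometry (T†) _ (by simpa using hT) (γ.toH (Ball.origin d))
    γ.adjoint_toH_comp_toH_origin (fun j => ?_) (fun j => ?_) j
  · exact γ.toH_adjoint_toH_origin hT (defect_mem_defectSpace (T†) _)
  · rw [adjoint_adjoint, adjoint_adjoint, toH_zeroPoint hT, inf_adjoint_zeroPoint hT, map_neg,
      neg_neg]

lemma isUnit_one_add_adjoint_zeroPoint_comp (z : Ball d) :
    IsUnit (1 + (γ.zeroPoint T)† ∘L γ.charFunIsometric z) := by
  have hn : ‖-((γ.zeroPoint T)† ∘L γ.charFunIsometric z)‖ < 1 := by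
    rw [norm_neg]
    calc _ ≤ ‖(γ.zeroPoint T)†‖ * ‖γ.charFunIsometric z‖ := opNorm_comp_le _ _
      _ ≤ 1 * ‖γ.charFunIsometric z‖ := by
        gcongr
        simpa using γ.norm_zeroPoint_le hT
      _ < 1 := by simpa using γ.norm_charFunIsometric_lt_one hT z
  simpa using isUnit_one_sub_of_norm_lt_one hn

/-- Up to the unitaries `γ(0)` and `γ(∞)`, the function `b_T` is `Θ_T`, for every row contraction
`T`, whether or not it is CCNC. -/
theorem toH_charFun (z : Ball d) (x : Jinf) :
    γ.toH (Ball.origin d) (charFun T γ z x) = nagyFoiasAux T z (γ.inf x) := by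
  have hmem : ∀ x, γ.toH (Ball.origin d)
      (((γ.toH (Ball.origin d))† ∘L nagyFoiasAux T z ∘L γ.inf) x) =
      nagyFoiasAux T z (γ.inf x) := fun x => by
    rw [comp_apply, comp_apply, toH_adjoint_toH_origin hT]
    exact nagyFoiasAux_mem T hT z ⟨γ.inf x, γ.inf_mem_defectSpace hT x⟩
  -- By uniqueness, it is enough that the left side solves the Frostman equation; applying `γ(0)`
  -- and `γ(∞)` moves that equation to `H`, where `defect_adjoint_nagyFoiasAux` settles it.
  have key : (γ.toH (Ball.origin d))† ∘L nagyFoiasAux T z ∘L γ.inf = charFun T γ z := by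
    refine eq_inverseFrostman _ _ _ (γ.norm_zeroPoint_le hT) (γ.isPureContraction_zeroPoint hT)
      (γ.norm_charFunIsometric_lt_one hT z) ?_
    ext x
    rw [← γ.adjoint_toH_toH_origin (comp _ _ x), comp_apply, toH_defect_adjoint_zeroPoint hT,
      hmem]
    set w := Ring.inverse (1 + (γ.zeroPoint T)† ∘L γ.charFunIsometric z)
      (defect (γ.zeroPoint T) x) with hw
    have hw1 : w + ((γ.zeroPoint T)†) (γ.charFunIsometric z w) = defect (γ.zeroPoint T) x := by
      simpa using DFunLike.congr_fun (Ring.mul_inverse_cancel _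
        (γ.isUnit_one_add_adjoint_zeroPoint_comp hT z)) (defect (γ.zeroPoint T) x)
    have hβ := γ.toH_charFunIsometric hT z w
    have hw2 := congrArg γ.inf hw1
    rw [map_add, inf_adjoint_zeroPoint hT, inf_defect_zeroPoint hT, hβ, ← sub_eq_add_neg] at hw2
    have hu := rowResolvent_apply (isometricPart T) (norm_isometricPart_le T hT) z
      (rowOp H z (γ.inf w))
    rw [defect_adjoint_nagyFoiasAux T hT (by rw [map_add, ← sub_eq_iff_eq_add, hu]) hw2, ← hβ,
      sub_eq_add_neg, ← toH_zeroPoint hT, ← map_add, adjoint_toH_toH_origin]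
    rfl
  rw [← key, hmem]

theorem coincide_charFun_nagyFoias : Coincide (charFun T γ) (nagyFoias T hT) := by
  -- Only at the origin is `γ(z)` required to be isometric, and there its range is the defect space
  -- of `T*`.
  let R₀ : J₀ ≃ₗᵢ[ℂ] (restrictedRange (isometricPart T) (Ball.origin d))ᗮ :=
    { (γ.equiv (Ball.origin d)).toLinearEquiv with norm_map' := γ.norm_equiv_origin }
  refine ⟨R₀.trans (LinearIsometryEquiv.ofEq _ _ (restrictedRange_origin_orthogonal T hT)),
    γ.equivInf.trans (LinearIsometryEquiv.ofEq _ _ (ker_isometricPart T hT)), fun z x => ?_⟩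
  exact Subtype.ext (γ.toH_charFun hT z x)

end CharFun

end ModelTriple

end RowContraction

theorem mainTheorem9 {d : ℕ} {H : Type*} [NormedAddCommGroup H] [InnerProductSpace ℂ H]
    [CompleteSpace H] (T : Copies d H →L[ℂ] H) (hT : ‖T‖ ≤ 1) (hC : IsCCNC T)
    {Jinf J₀ : Type*}
    [NormedAddCommGroup Jinf] [InnerProductSpace ℂ Jinf] [CompleteSpace Jinf]
    [NormedAddCommGroup J₀] [InnerProductSpace ℂ J₀] [CompleteSpace J₀]
    (γ : ModelTriple (isometricPart T) Jinf J₀)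
    {E F : Type*}
    [NormedAddCommGroup E] [InnerProductSpace ℂ E] [CompleteSpace E]
    [NormedAddCommGroup F] [InnerProductSpace ℂ F] [CompleteSpace F] :
    IsSchur (charFun T γ) ∧ IsSchur (nagyFoias T hT) ∧
      CoincideWeakly (charFun T γ) (nagyFoias T hT) ∧
      ∀ b : Ball d → E →L[ℂ] F, IsSchur b → CoincideWeakly b (charFun T γ) →
        CoincideWeakly b (nagyFoias T hT) := by
  have hco := γ.coincide_charFun_nagyFoias hT
  exact ⟨isSchur_of_coincide_of_factorization _ _ hco _ (nagyFoias_factorization T hT),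
    isSchur_of_factorization _ _ (nagyFoias_factorization T hT), hco.coincideWeakly,
    fun b _ hb => Coincide.trans hb hco.coincideWeakly⟩
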